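/- \textbf{Theorem.} A polynomial $p(q)\in\mathbb{R}[q]$ is called $q$-nonnegative if all its coefficients are nonnegative, and an infinite matrix $(m_{i,j}(q))_{i,j\ge 0}$ over $\mathbb{R}[q]$ is called $q$-totally positive if each of its minors (of every order) is $q$-nonnegative. Let $C=(c_{n,k}(q))_{n,k\ge 0}$ be the Catalan--Stieltjes matrix, with $c_{0,0}(q)=1$ and $c_{n,k}(q)=0$ unless $n\ge k\ge 0$, generated by one of the following two recurrences, where $e,f$ are real numbers. (1) For some $f\ge e\ge 0$, \begin{align*} c_{n,0}(q)&=\bigl[(f-e)+eq\bigr]\,c_{n-1,0}(q)+fq\,c_{n-1,1}(q) && (n\ge 1),\\ c_{n,k}(q)&=c_{n-1,k-1}(q)+(1+q)\,c_{n-1,k}(q)+q\,c_{n-1,k+1}(q) && (k\ge 1,\ n\ge 1). \end{align*} (2) For some $e,f\ge 1$, \begin{align*} c_{n,0}(q)&=\bigl[(f-1)+eq\bigr]\,c_{n-1,0}(q)+efq\,c_{n-1,1}(q) && (n\ge 1),\\ c_{n,k}(q)&=c_{n-1,k-1}(q)+(1+eq)\,c_{n-1,k}(q)+eq\,c_{n-1,k+1}(q)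 && (k\ge 1,\ n\ge 1). \end{align*} Then the Hankel matrix $(c_{i+j,0}(q))_{i,j\ge 0}$ is $q$-totally positive. -/

import Mathlib

/-- A real polynomial `p(q)` is `q`-nonnegative if all its coefficients are nonnegative. -/
def QNonneg (p : Polynomial ℝ) : Prop :=
  ∀ m : ℕ, 0 ≤ p.coeff m

/-- An infinite matrix of real polynomials (rows and columns indexed by `0, 1, 2, …`) is
`q`-totally positive if all its minors, of every order, are `q`-nonnegative. -/
def QTotallyPositive (M : Matrix ℕ ℕ (Polynomial ℝ)) : Prop :=
  ∀ (k : ℕ) (I J : Fin k → ℕ), StrictMono I → StrictMono J → QNonneg (M.submatrix I J).det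

/-- The entries `c_{n,k}(q)` of the Catalan–Stieltjes matrix of the sequences `(r_k)_{k ≥ 0}`,
`(s_k)_{k ≥ 0}` and `(t_k)_{k ≥ 1}`; the value `t 0` is never used. -/
noncomputable def catalanStieltjes (r s t : ℕ → Polynomial ℝ) : ℕ → ℕ → Polynomial ℝ
  | 0, 0 => 1
  | 0, _ + 1 => 0
  | n + 1, 0 => s 0 * catalanStieltjes r s t n 0 + t 1 * catalanStieltjes r s t n 1
  | n + 1, k + 1 =>
      r k * catalanStieltjes r s t n k + s (k + 1) * catalanStieltjes r s t n (k + 1)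
        + t (k + 2) * catalanStieltjes r s t n (k + 2)

/-- The array is lower triangular: `c_{n,k}(q) = 0` for `k > n`. -/
theorem catalanStieltjes_eq_zero_of_lt (r s t : ℕ → Polynomial ℝ) (n k : ℕ) (h : n < k) :
    catalanStieltjes r s t n k = 0 := by
  induction n generalizing k with
  | zero =>
    obtain ⟨j, rfl⟩ : ∃ j, k = j + 1 := ⟨k - 1, by omega⟩
    simp [catalanStieltjes]
  | succ n ih =>
    obtain ⟨j, rfl⟩ : ∃ j, k = j + 1 := ⟨k - 1, by omega⟩
    simp [catalanStieltjes, ih j (by omega), ih (j + 1) (by omega), ih (j + 2) (by omega)]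

/-- The Hankel matrix `(a_{i+j})_{i,j ≥ 0}` of a sequence of polynomials. -/
def hankelMatrix (a : ℕ → Polynomial ℝ) : Matrix ℕ ℕ (Polynomial ℝ) :=
  Matrix.of fun i j => a (i + j)

open Polynomial Finset

/-! Let `C` be the Catalan–Stieltjes matrix, `J` its tridiagonal production matrix and `T` the
diagonal matrix with entries `t 1 ⋯ t l`. The Hankel matrix factors as `C T Cᵗ`, so by Cauchy–Binet
it suffices that `C` is totally positive, and this follows from total positivity of `J`.

Both recurrences have the same shape: `J` has corner `α + β Q`, entry `(α + β) Q` below it, and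
otherwise `1`, `1 + Q`, `Q` along its three diagonals. Column 0 of `J` is thus `α` times that of
`J₁` plus `β` times that of `J₂`, where `J₁` and `J₂` have corner `1` and `Q` and agree with `J` in
all other columns. Each `Jᵢ` is a product of two nonnegative bidiagonal matrices, and minors are
linear in column 0. -/

theorem QNonneg.zero : QNonneg 0 := fun m => by simp

theorem QNonneg.C {a : ℝ} (ha : 0 ≤ a) : QNonneg (C a) := fun m => by
  rw [coeff_C]; split_ifs <;> simp [ha]

theorem QNonneg.one : QNonneg 1 := by simpa using QNonneg.C zero_le_one

theorem QNonneg.X : QNonneg (X : ℝ[X]) := fun m => by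
  rw [coeff_X]; split_ifs <;> simp

theorem QNonneg.add {p q : ℝ[X]} (hp : QNonneg p) (hq : QNonneg q) : QNonneg (p + q) := fun m => by
  rw [coeff_add]; exact add_nonneg (hp m) (hq m)

theorem QNonneg.mul {p q : ℝ[X]} (hp : QNonneg p) (hq : QNonneg q) : QNonneg (p * q) := fun m => by
  rw [coeff_mul]; exact sum_nonneg fun x _ => mul_nonneg (hp _) (hq _)

theorem QNonneg.sum {ι : Type*} {s : Finset ι} {f : ι → ℝ[X]} (h : ∀ i ∈ s, QNonneg (f i)) :
    QNonneg (∑ i ∈ s, f i) :=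
  sum_induction f QNonneg (fun _ _ => QNonneg.add) QNonneg.zero h

theorem QNonneg.prod {ι : Type*} {s : Finset ι} {f : ι → ℝ[X]} (h : ∀ i ∈ s, QNonneg (f i)) :
    QNonneg (∏ i ∈ s, f i) :=
  prod_induction f QNonneg (fun _ _ => QNonneg.mul) QNonneg.one h

/-! ### Cauchy–Binet and closure properties of total positivity -/

/-- The determinant of a product of a `k × N` and an `N × k` matrix, as a sum over all maps. -/
theorem det_sum_range_mul {R : Type*} [CommRing R] {k : ℕ} (N : ℕ) (A : Matrix (Fin k) ℕ R)
    (B : Matrix ℕ (Fin k) R) :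
    (Matrix.of fun i j => ∑ l ∈ range N, A i l * B l j).det =
      ∑ p ∈ Fintype.piFinset fun _ : Fin k => range N,
        (∏ i, A i (p i)) * (B.submatrix p id).det := by
  have h : (Matrix.of fun i j => ∑ l ∈ range N, A i l * B l j) =
      fun i => ∑ l ∈ range N, A i l • B l := by
    ext i j
    simp [Finset.sum_apply]
  rw [h]
  change (Matrix.detRowAlternating (R := R) (n := Fin k)).toMultilinearMap _ = _
  rw [MultilinearMap.map_sum_finset]
  refine sum_congr rfl fun p _ => ?_
  rw [MultilinearMap.map_smul_univ]
  rfl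

/-- The **Cauchy–Binet formula**. -/
theorem det_sum_range_mul_eq_sum_strictMono {R : Type*} [CommRing R] {k : ℕ} (N : ℕ)
    (A : Matrix (Fin k) ℕ R) (B : Matrix ℕ (Fin k) R) :
    (Matrix.of fun i j => ∑ l ∈ range N, A i l * B l j).det =
      ∑ g ∈ (Fintype.piFinset fun _ : Fin k => range N) with StrictMono g,
        (A.submatrix id g).det * (B.submatrix g id).det := by
  rw [det_sum_range_mul]
  have hmaps : ∀ p ∈ Fintype.piFinset fun _ : Fin k => range N,
      p ∘ Tuple.sort p ∈ Fintype.piFinset fun _ : Fin k => range N := by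
    intro p hp
    rw [Fintype.mem_piFinset] at hp ⊢
    exact fun i => hp _
  -- Group the maps by their sorted rearrangement `g`. If `g` is strictly monotone, its fibre is `{g
  -- ∘ σ}` and sums to the minor of `A`; otherwise each map in the fibre repeats a value, so `B`
  -- contributes two equal rows.
  rw [← sum_fiberwise_of_maps_to hmaps, sum_filter]
  refine sum_congr rfl fun g hg => ?_
  split_ifs with hmono
  · rw [← Matrix.det_transpose (A.submatrix id g), Matrix.det_apply', sum_mul]
    symm
    refine sum_bij (fun σ _ => g ∘ σ) ?_ ?_ ?_ ?_
    · intro σ _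
      rw [mem_filter]
      refine ⟨?_, ?_⟩
      · rw [Fintype.mem_piFinset] at hg ⊢
        exact fun i => hg _
      · rw [Tuple.comp_perm_comp_sort_eq_comp_sort,
          Tuple.sort_eq_refl_iff_monotone.2 hmono.monotone]
        rfl
    · intro σ _ τ _ h
      ext i
      exact congrArg Fin.val (hmono.injective (congrFun h i))
    · intro p hp
      refine ⟨(Tuple.sort p)⁻¹, mem_univ _, ?_⟩
      rw [← (mem_filter.1 hp).2]
      ext i
      simp
    · intro σ _
      have h : B.submatrix (g ∘ σ) id = (B.submatrix g id).submatrix σ id := rfl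
      rw [h, Matrix.det_permute]
      simp only [Matrix.transpose_apply, Matrix.submatrix_apply, id, Function.comp]
      ring
  · refine sum_eq_zero fun p hp => ?_
    rw [mem_filter] at hp
    have hnot : ¬ Function.Injective p := fun hinj => hmono <| by
      rw [← hp.2]
      exact (Tuple.monotone_sort p).strictMono_of_injective
        (hinj.comp (Tuple.sort p).injective)
    obtain ⟨i, j, hij, hne⟩ : ∃ i j, p i = p j ∧ i ≠ j := by
      simpa [Function.Injective] using hnot
    rw [Matrix.det_zero_of_row_eq hne, mul_zero]
    ext l
    simp [hij]

/-- Total positivity is preserved by products whose left factor has at most one nonzero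
superdiagonal. -/
theorem QTotallyPositive.of_eq_sum {A B P : Matrix ℕ ℕ ℝ[X]} (hA : QTotallyPositive A)
    (hB : QTotallyPositive B) (hzero : ∀ i l, i + 1 < l → A i l = 0)
    (hP : ∀ i j, P i j = ∑ l ∈ range (i + 2), A i l * B l j) : QTotallyPositive P := by
  intro k I J hI hJ
  have h : P.submatrix I J = Matrix.of fun i j =>
      ∑ l ∈ range (univ.sup I + 2), A.submatrix I id i l * B.submatrix id J l j := by
    ext1 i j
    have hi : I i ≤ univ.sup I := le_sup (mem_univ i)
    simp only [Matrix.submatrix_apply, Matrix.of_apply, id, hP]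
    refine sum_subset (range_mono (by omega)) fun l _ hl => ?_
    rw [mem_range] at hl
    rw [hzero _ _ (by omega), zero_mul]
  rw [h, det_sum_range_mul_eq_sum_strictMono]
  refine QNonneg.sum fun g hg => ?_
  have hg' := (mem_filter.1 hg).2
  exact (hA k I g hI hg').mul (hB k g J hg' hJ)

theorem QTotallyPositive.transpose {A : Matrix ℕ ℕ ℝ[X]} (hA : QTotallyPositive A) :
    QTotallyPositive A.transpose := by
  intro k I J hI hJ
  rw [← Matrix.transpose_submatrix, Matrix.det_transpose]
  exact hA k J I hJ hI

theorem QTotallyPositive.mul_row {A : Matrix ℕ ℕ ℝ[X]} (hA : QTotallyPositive A) {w : ℕ → ℝ[X]}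
    (hw : ∀ i, QNonneg (w i)) : QTotallyPositive (Matrix.of fun i j => w i * A i j) := by
  intro k I J hI hJ
  have h : (Matrix.of fun i j => w i * A i j).submatrix I J =
      Matrix.of fun i j => w (I i) * A.submatrix I J i j := rfl
  rw [h, Matrix.det_mul_column]
  exact (QNonneg.prod fun i _ => hw _).mul (hA k I J hI hJ)

theorem det_eq_mul_of_row_zero {R : Type*} [CommRing R] {k : ℕ}
    (M : Matrix (Fin (k + 1)) (Fin (k + 1)) R) (h : ∀ j : Fin k, M 0 j.succ = 0) :
    M.det = M 0 0 * (M.submatrix Fin.succ Fin.succ).det := by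
  rw [Matrix.det_succ_row_zero, Fin.sum_univ_succ]
  simp [h]

theorem det_eq_mul_of_column_zero {R : Type*} [CommRing R] {k : ℕ}
    (M : Matrix (Fin (k + 1)) (Fin (k + 1)) R) (h : ∀ i : Fin k, M i.succ 0 = 0) :
    M.det = M 0 0 * (M.submatrix Fin.succ Fin.succ).det := by
  rw [← Matrix.det_transpose, det_eq_mul_of_row_zero _ h]
  rw [← Matrix.det_transpose (M.submatrix _ _)]
  rfl

/-- The lower bidiagonal matrix with constant diagonal `d` and constant subdiagonal `x`. -/
noncomputable def lowerBidiagonal (d x : ℝ[X]) : Matrix ℕ ℕ ℝ[X] :=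
  Matrix.of fun i j => (if i = j then d else 0) + if i = j + 1 then x else 0

theorem lowerBidiagonal_eq_zero (d x : ℝ[X]) {i j : ℕ} (h : i ≠ j) (h' : i ≠ j + 1) :
    lowerBidiagonal d x i j = 0 := by
  simp [lowerBidiagonal, h, h']

theorem qTotallyPositive_lowerBidiagonal {d x : ℝ[X]} (hd : QNonneg d) (hx : QNonneg x) :
    QTotallyPositive (lowerBidiagonal d x) := by
  intro k
  induction k with
  | zero => intro I J _ _; simpa using QNonneg.one
  | succ k ih =>
    intro I J hI hJ
    have hentry : ∀ i j, QNonneg (lowerBidiagonal d x i j) := by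
      intro i j
      simp only [lowerBidiagonal, Matrix.of_apply]
      refine QNonneg.add ?_ ?_ <;> split_ifs <;> simp only [hd, hx, QNonneg.zero]
    have hminor := (hentry (I 0) (J 0)).mul
      (ih (I ∘ Fin.succ) (J ∘ Fin.succ) (hI.comp (Fin.strictMono_succ))
        (hJ.comp (Fin.strictMono_succ)))
    -- The support is `j ≤ i ≤ j + 1`: in the first case row 0 of the minor vanishes past its first
    -- entry, in the second column 0 does.
    rcases le_or_gt (I 0) (J 0) with h | h
    · rw [det_eq_mul_of_row_zero]
      · exact hminor
      · intro j
        have := hJ (Fin.succ_pos j)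
        exact lowerBidiagonal_eq_zero d x (by omega) (by omega)
    · rw [det_eq_mul_of_column_zero]
      · exact hminor
      · intro i
        have := hI (Fin.succ_pos i)
        exact lowerBidiagonal_eq_zero d x (by omega) (by omega)

/-! ### From the production matrix to the Catalan–Stieltjes matrix -/

/-- The tridiagonal production matrix of a Catalan–Stieltjes matrix. -/
noncomputable def jacobiMatrix (r s t : ℕ → ℝ[X]) : Matrix ℕ ℕ ℝ[X] :=
  Matrix.of fun i j =>
    (if j = i + 1 then r i else 0) + (if i = j then s j else 0) + if i = j + 1 then t i else 0

theorem jacobiMatrix_eq_zero (r s t : ℕ → ℝ[X]) {i j : ℕ} (h : j ≠ i + 1) (h' : i ≠ j)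
    (h'' : i ≠ j + 1) : jacobiMatrix r s t i j = 0 := by
  simp [jacobiMatrix, h, h', h'']

/-- Truncation at `N` is harmless if it covers the support of row `n` of the array or that of column
`m` of the Jacobi matrix. -/
theorem catalanStieltjes_succ_eq_sum (r s t : ℕ → ℝ[X]) {n m N : ℕ} (h : n < N ∨ m + 1 < N) :
    catalanStieltjes r s t (n + 1) m =
      ∑ l ∈ range N, catalanStieltjes r s t n l * jacobiMatrix r s t l m := by
  have hz := catalanStieltjes_eq_zero_of_lt r s t n
  have hite : ∀ (a : ℕ) (w : ℝ[X]), a ≤ m + 1 →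
      (∑ l ∈ range N, catalanStieltjes r s t n l * if l = a then w else 0) =
        catalanStieltjes r s t n a * w := by
    intro a w ha
    simp only [mul_ite, mul_zero, sum_ite_eq', mem_range]
    split_ifs with haN
    · rfl
    · rw [hz a (by omega), zero_mul]
  cases m with
  | zero =>
    have hJ : ∀ l, jacobiMatrix r s t l 0 =
        (if l = 0 then s 0 else 0) + if l = 1 then t 1 else 0 := by
      intro l
      by_cases h1 : l = 1 <;> simp [jacobiMatrix, h1]
    simp only [hJ, mul_add, sum_add_distrib]
    rw [hite 0 _ (by omega), hite 1 _ (by omega), catalanStieltjes]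
    ring
  | succ m =>
    have hJ : ∀ l, jacobiMatrix r s t l (m + 1) =
        (if l = m then r m else 0) + (if l = m + 1 then s (m + 1) else 0) +
          if l = m + 2 then t (m + 2) else 0 := by
      intro l
      by_cases h1 : l = m
      · subst h1; simp [jacobiMatrix, show l ≠ l + 1 + 1 by omega]
      · by_cases h2 : l = m + 2
        · subst h2; simp [jacobiMatrix]
        · simp [jacobiMatrix, h1, h2, Ne.symm h1]
    simp only [hJ, mul_add, sum_add_distrib]
    rw [hite m _ (by omega), hite (m + 1) _ (by omega), hite (m + 2) _ (by omega),
      catalanStieltjes]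
    ring

/-- Deleting row 0 of `C` gives `C J`, so Cauchy–Binet reduces minors avoiding row 0 to minors with
smaller row indices. Row 0 is `(1, 0, 0, …)` and splits off by expansion. -/
theorem QTotallyPositive.catalanStieltjes {r s t : ℕ → ℝ[X]}
    (hJ : QTotallyPositive (jacobiMatrix r s t)) :
    QTotallyPositive (Matrix.of (catalanStieltjes r s t)) := by
  suffices H : ∀ N k (I J : Fin k → ℕ), (∀ i, I i < N) → StrictMono I → StrictMono J →
      QNonneg ((Matrix.of (_root_.catalanStieltjes r s t)).submatrix I J).det from
    fun k I J => H (univ.sup I + 1) k I J fun i => Nat.lt_succ_of_le (le_sup (mem_univ i))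
  intro N
  induction N with
  | zero =>
    intro k I J hN _ _
    cases k with
    | zero => simpa using QNonneg.one
    | succ k => exact absurd (hN 0) (by omega)
  | succ N ih =>
    have hpos : ∀ k (I J : Fin k → ℕ), (∀ i, I i < N + 1) → (∀ i, 0 < I i) → StrictMono I →
        StrictMono J →
        QNonneg ((Matrix.of (_root_.catalanStieltjes r s t)).submatrix I J).det := by
      intro k I J hN h0 hI hJm
      have h : (Matrix.of (_root_.catalanStieltjes r s t)).submatrix I J = Matrix.of fun i j =>
          ∑ l ∈ range N, (Matrix.of (_root_.catalanStieltjes r s t)).submatrix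
            (fun i => I i - 1) id i l * (jacobiMatrix r s t).submatrix id J l j := by
        ext1 i j
        obtain ⟨n, hn⟩ : ∃ n, I i = n + 1 := ⟨I i - 1, by have := h0 i; omega⟩
        have := hN i
        simp only [Matrix.submatrix_apply, Matrix.of_apply, id, hn, Nat.add_sub_cancel]
        exact catalanStieltjes_succ_eq_sum r s t (Or.inl (by omega))
      rw [h, det_sum_range_mul_eq_sum_strictMono]
      refine QNonneg.sum fun g hg => ?_
      have hg' := (mem_filter.1 hg).2
      refine (ih k (fun i => I i - 1) g (fun i => ?_) (fun i j hij => ?_) hg').mul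
        (hJ k g J hg' hJm)
      · have := hN i
        have := h0 i
        omega
      · have := hI hij
        have := h0 i
        show I i - 1 < I j - 1
        omega
    intro k I J hN hI hJm
    cases k with
    | zero => simpa using QNonneg.one
    | succ k =>
      rcases Nat.eq_zero_or_pos (I 0) with h | h
      · rw [det_eq_mul_of_row_zero]
        · refine QNonneg.mul ?_ (hpos k (I ∘ Fin.succ) (J ∘ Fin.succ) (fun i => hN _) (fun i => ?_)
            (hI.comp Fin.strictMono_succ) (hJm.comp Fin.strictMono_succ))
          · simp only [Matrix.submatrix_apply, Matrix.of_apply, h]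
            rcases J 0 with _ | j
            · simpa [_root_.catalanStieltjes] using QNonneg.one
            · simpa [_root_.catalanStieltjes] using QNonneg.zero
          · exact (Nat.zero_le _).trans_lt (hI (Fin.succ_pos i))
        · intro j
          have := hJm (Fin.succ_pos j)
          simp only [Matrix.submatrix_apply, Matrix.of_apply, h]
          exact catalanStieltjes_eq_zero_of_lt r s t _ _ (by omega)
      · exact hpos _ I J hN (fun i => h.trans_le (hI.monotone (Fin.zero_le i))) hI hJm

/-! ### Factorization of the Hankel matrix -/

/-- The diagonal matrix `T` symmetrizes `J`: `J T = T Jᵗ`. -/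
theorem jacobiMatrix_mul_prod (s t : ℕ → ℝ[X]) (m l : ℕ) :
    jacobiMatrix (fun _ => 1) s t m l * ∏ a ∈ range l, t (a + 1) =
      (∏ a ∈ range m, t (a + 1)) * jacobiMatrix (fun _ => 1) s t l m := by
  by_cases h1 : l = m + 1
  · subst h1
    simp [jacobiMatrix, prod_range_succ, show m ≠ m + 1 + 1 by omega, mul_comm]
  by_cases h2 : m = l
  · subst h2
    simp [jacobiMatrix, mul_comm]
  by_cases h3 : m = l + 1
  · subst h3
    simp [jacobiMatrix, prod_range_succ, show l ≠ l + 1 + 1 by omega, mul_comm]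
  rw [jacobiMatrix_eq_zero _ _ _ h1 h2 h3, jacobiMatrix_eq_zero _ _ _ h3 (Ne.symm h2) h1]
  simp

/-- Writing `C_i` for row `i`, one step of the recurrence moves across `T`: `C_{i+1} T C_jᵗ = C_i J
T C_jᵗ = C_i T Jᵗ C_jᵗ = C_i T C_{j+1}ᵗ`. -/
theorem catalanStieltjes_add_zero (s t : ℕ → ℝ[X]) (i j : ℕ) :
    catalanStieltjes (fun _ => 1) s t (i + j) 0 =
      ∑ l ∈ range (i + 1), catalanStieltjes (fun _ => 1) s t i l *
        ((∏ a ∈ range l, t (a + 1)) * catalanStieltjes (fun _ => 1) s t j l) := by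
  induction i generalizing j with
  | zero => simp [catalanStieltjes]
  | succ i ih =>
    have h1 : ∀ l, catalanStieltjes (fun _ => 1) s t (i + 1) l = _ := fun l =>
      catalanStieltjes_succ_eq_sum (fun _ => 1) s t (N := i + 1) (Or.inl (by omega))
    have h2 : ∀ m ∈ range (i + 1), catalanStieltjes (fun _ => 1) s t (j + 1) m = _ := fun m hm =>
      catalanStieltjes_succ_eq_sum (fun _ => 1) s t (N := i + 1 + 1)
        (Or.inr (by rw [mem_range] at hm; omega))
    rw [show i + 1 + j = i + (j + 1) by ring, ih,
      sum_congr rfl fun m hm => by rw [h2 m hm]]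
    simp only [h1, sum_mul, mul_sum]
    rw [sum_comm]
    refine sum_congr rfl fun l _ => sum_congr rfl fun m _ => ?_
    linear_combination (-catalanStieltjes (fun _ => 1) s t i m *
      catalanStieltjes (fun _ => 1) s t j l) * jacobiMatrix_mul_prod s t m l

theorem qTotallyPositive_hankelMatrix {s t : ℕ → ℝ[X]} (ht : ∀ k, QNonneg (t k))
    (hJ : QTotallyPositive (jacobiMatrix (fun _ => 1) s t)) :
    QTotallyPositive (hankelMatrix fun n => catalanStieltjes (fun _ => 1) s t n 0) := by
  have hC := hJ.catalanStieltjes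
  refine hC.of_eq_sum (hC.transpose.mul_row
    (w := fun l => ∏ a ∈ range l, t (a + 1)) fun l => QNonneg.prod fun a _ => ht _) ?_ ?_
  · intro i l h
    exact catalanStieltjes_eq_zero_of_lt _ _ _ _ _ (by omega)
  · intro i j
    simp only [hankelMatrix, Matrix.of_apply, Matrix.transpose_apply]
    -- `of_eq_sum` sums one term further; that term lies above the diagonal of `C`.
    rw [catalanStieltjes_add_zero, sum_range_succ _ (i + 1),
      catalanStieltjes_eq_zero_of_lt _ _ _ i (i + 1) (by omega), zero_mul, add_zero]

/-! ### Total positivity of the production matrices -/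

/-- A tridiagonal matrix with a lower-upper factorization into bidiagonal matrices. -/
theorem qTotallyPositive_jacobiMatrix_of_factor {x y : ℝ[X]} (hx : QNonneg x) (hy : QNonneg y) :
    QTotallyPositive
      (jacobiMatrix (fun _ => 1) (fun k => if k = 0 then y else x + y) fun _ => x * y) := by
  refine (qTotallyPositive_lowerBidiagonal QNonneg.one hx).of_eq_sum
    (qTotallyPositive_lowerBidiagonal hy QNonneg.one).transpose ?_ ?_
  · intro i l h
    exact lowerBidiagonal_eq_zero _ _ (by omega) (by omega)
  · intro i j
    simp only [lowerBidiagonal, Matrix.transpose_apply, Matrix.of_apply, add_mul, sum_add_distrib,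
      ite_mul, zero_mul, one_mul, sum_ite_eq, mem_range]
    rw [if_pos (show i < i + 2 by omega)]
    cases i with
    | zero =>
      rcases j with _ | _ | j <;> simp [jacobiMatrix]
    | succ i =>
      simp only [Nat.add_right_cancel_iff, sum_ite_eq, mem_range]
      rw [if_pos (show i < i + 1 + 2 by omega)]
      simp only [jacobiMatrix, Matrix.of_apply]
      split_ifs <;> first | omega | ring

theorem qTotallyPositive_jacobiMatrix {Q α β : ℝ[X]} (hQ : QNonneg Q) (hα : QNonneg α)
    (hβ : QNonneg β) :
    QTotallyPositive (jacobiMatrix (fun _ => 1)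
      (fun k => if k = 0 then α + β * Q else 1 + Q)
      fun k => if k = 1 then (α + β) * Q else Q) := by
  have h1 := qTotallyPositive_jacobiMatrix_of_factor hQ QNonneg.one
  have h2 := qTotallyPositive_jacobiMatrix_of_factor QNonneg.one hQ
  set J := jacobiMatrix (fun _ => 1) (fun k => if k = 0 then α + β * Q else 1 + Q)
    fun k => if k = 1 then (α + β) * Q else Q
  set J₁ := jacobiMatrix (fun _ => 1) (fun k => if k = 0 then 1 else Q + 1) fun _ => Q * 1
  set J₂ := jacobiMatrix (fun _ => 1) (fun k => if k = 0 then Q else 1 + Q) fun _ => 1 * Q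
  have hcol0 : ∀ i, J i 0 = α * J₁ i 0 + β * J₂ i 0 := by
    rintro (_ | _ | i)
    · simp [J, J₁, J₂, jacobiMatrix]
    · simp [J, J₁, J₂, jacobiMatrix]
      ring
    · simp [J, J₁, J₂, jacobiMatrix]
  have hcol1 : ∀ i j, 0 < j → J i j = J₁ i j := by
    intro i j hj
    by_cases hij : i = j + 1
    · simp [J, J₁, jacobiMatrix, hij, hj.ne']
    · simp [J, J₁, jacobiMatrix, hij, hj.ne', add_comm]
  have hcol2 : ∀ i j, 0 < j → J₂ i j = J₁ i j := by
    intro i j hj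
    simp [J₁, J₂, jacobiMatrix, hj.ne', add_comm]
  intro k I K hI hK
  cases k with
  | zero => simpa using QNonneg.one
  | succ k =>
    rcases Nat.eq_zero_or_pos (K 0) with h | h
    · have hpos : ∀ j, j ≠ 0 → 0 < K j := fun j hj =>
        (Nat.zero_le _).trans_lt (hK (Fin.pos_iff_ne_zero.2 hj))
      have hJ : J.submatrix I K = (J₁.submatrix I K).updateCol 0
          ((α • fun i => J₁ (I i) 0) + β • fun i => J₂ (I i) 0) := by
        ext1 i j
        by_cases hj : j = 0
        · subst hj
          simp [h, hcol0]
        · simp [Matrix.updateCol_ne hj, hcol1 _ _ (hpos j hj)]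
      have hJ1 : (J₁.submatrix I K).updateCol 0 (fun i => J₁ (I i) 0) = J₁.submatrix I K := by
        ext1 i j
        by_cases hj : j = 0
        · subst hj
          simp [h]
        · simp [Matrix.updateCol_ne hj]
      have hJ2 : (J₁.submatrix I K).updateCol 0 (fun i => J₂ (I i) 0) = J₂.submatrix I K := by
        ext1 i j
        by_cases hj : j = 0
        · subst hj
          simp [h]
        · simp [Matrix.updateCol_ne hj, hcol2 _ _ (hpos j hj)]
      -- Only a minor using column 0 sees the difference between the three matrices; it splits
      -- linearly there.
      rw [hJ, Matrix.det_updateCol_add, Matrix.det_updateCol_smul, Matrix.det_updateCol_smul, hJ1,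
        hJ2]
      exact (hα.mul (h1 _ I K hI hK)).add (hβ.mul (h2 _ I K hI hK))
    · have hJ : J.submatrix I K = J₁.submatrix I K := by
        ext1 i j
        exact hcol1 _ _ (h.trans_le (hK.monotone (Fin.zero_le j)))
      rw [hJ]
      exact h1 _ I K hI hK

theorem qTotallyPositive_hankelMatrix_catalanStieltjes {Q α β : ℝ[X]} (hQ : QNonneg Q)
    (hα : QNonneg α) (hβ : QNonneg β) :
    QTotallyPositive (hankelMatrix fun n => catalanStieltjes (fun _ => 1)
      (fun k => if k = 0 then α + β * Q else 1 + Q)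
      (fun k => if k = 1 then (α + β) * Q else Q) n 0) := by
  refine qTotallyPositive_hankelMatrix (fun k => ?_) (qTotallyPositive_jacobiMatrix hQ hα hβ)
  split_ifs
  · exact (hα.add hβ).mul hQ
  · exact hQ

theorem mainTheorem3 :
    (∀ e f : ℝ, 0 ≤ e → e ≤ f →
      QTotallyPositive (hankelMatrix fun n =>
        catalanStieltjes
          (fun _ => 1)
          (fun k => if k = 0 then Polynomial.C (f - e) + Polynomial.C e * Polynomial.X
            else 1 + Polynomial.X)
          (fun k => if k = 1 then Polynomial.C f * Polynomial.X else Polynomial.X)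
          n 0)) ∧
    (∀ e f : ℝ, 1 ≤ e → 1 ≤ f →
      QTotallyPositive (hankelMatrix fun n =>
        catalanStieltjes
          (fun _ => 1)
          (fun k => if k = 0 then Polynomial.C (f - 1) + Polynomial.C e * Polynomial.X
            else 1 + Polynomial.C e * Polynomial.X)
          (fun k => if k = 1 then Polynomial.C (e * f) * Polynomial.X
            else Polynomial.C e * Polynomial.X)
          n 0)) := by
  refine ⟨fun e f he hef => ?_, fun e f he hf => ?_⟩
  -- `Q = q`, `α = f - e`, `β = e`.
  · have h := qTotallyPositive_hankelMatrix_catalanStieltjes QNonneg.X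
      (QNonneg.C (sub_nonneg.2 hef)) (QNonneg.C he)
    rwa [← Polynomial.C_add, sub_add_cancel] at h
  -- `Q = e q`, `α = f - 1`, `β = 1`.
  · have h := qTotallyPositive_hankelMatrix_catalanStieltjes
      ((QNonneg.C (zero_le_one.trans he)).mul QNonneg.X) (QNonneg.C (sub_nonneg.2 hf)) QNonneg.one
    rwa [one_mul, ← Polynomial.C_1, ← Polynomial.C_add, sub_add_cancel, ← mul_assoc,
      ← Polynomial.C_mul, mul_comm f e, Polynomial.C_1] at h
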